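/- Let $A\in\mathbb C^{n\times n}$, $B,X_0\in\mathbb C^{n\times L}$, $F_0=B-AX_0$, and let $\mathbb K_i$ denote the span of the columns of $F_0,AF_0,\dots,A^{i-1}F_0$ (so $\mathbb K_0=\{0\}$). The block FOM approximation $X_i^{(F)}$ is characterized by: the columns of $X_i^{(F)}-X_0$ lie in $\mathbb K_i$ and the columns of $B-AX_i^{(F)}$ are orthogonal to $\mathbb K_i$. The block GMRES approximation $X_i^{(G)}$ is characterized by: the columns of $X_i^{(G)}-X_0$ lie in $\mathbb K_i$ and the columns of $B-AX_i^{(G)}$ are orthogonal to $A\mathbb K_i$. Let $j\ge 1$ and assume that $\dim\mathbb K_j=jL$ (no breakdown). Let the block Arnoldi process give $V_1,\dots,V_{j+1}\in\mathbb C^{n\times L}$ such that $W_{j+1}=[V_1\ \cdots\ V_{j+1}]$ has orthonormal columns, $F_0=V_1S_0$ with $S_0$ upper triangular, and $AW_j=W_{j+1}\overline H_j^{(B)}$, where $W_j=[V_1\ \cdots\ V_j]$ and $\overline H_j^{(B)}=(H_{i,l})\in\mathbb C^{(j+1)L\times jL}$ is block upper Hessenberg with $L\times L$ blocks and upper triangular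 subdiagonal blocks $H_{l+1,l}$. Let $H_j^{(B)}$ be the matrix of the first $jL$ rows of $\overline H_j^{(B)}$. Let $\widehat{\mathcal H}_1,\dots,\widehat{\mathcal H}_j\in\mathbb C^{2L\times 2L}$ be unitary, and let $Q_i^{(m)}$ be the $mL\times mL$ matrix that acts by $\widehat{\mathcal H}_i$ on the block rows $i,i+1$ and is the identity elsewhere. Assume that they compute a QR factorization of $\overline H_j^{(B)}$ block column by block column: for every $i\le j$, all entries below the main diagonal in block column $i$ of $Q_i^{(j+1)}\cdots Q_1^{(j+1)}\overline H_j^{(B)}$ vanish. Let $\widehat H_{jj}$ be the last $L\times L$ diagonal block of $Q_{j-1}^{(j)}\cdots Q_1^{(j)}H_j^{(B)}$, let $\widehat H_{jj}=\widehat M_j\widehat Y$ be a QR factorization ($\widehat M_j$ unitary, $\widehat Y$ upper triangular), let $\widehat Q_j^{(j)}=\operatorname{diag}(I_{(j-1)L},\widehat M_j^*)$, and let $\widehat C_j\in\mathbb C^{L\times L}$ consist of the last $L$ rows of $\widehat Q_j^{(j)}Q_{j-1}^{(j)}\cdots Q_1^{(j)}\begin{bmatrix}S_0\\0\end{bmatrix}$.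 Finally let $$\widehat{\mathcal H}_j=\begin{bmatrix}\mathcal U_1\mathcal C\mathcal V_1^*&\mathcal U_1\mathcal S\mathcal V_2^*\\ \mathcal U_2\mathcal S\mathcal V_1^*&-\mathcal U_2\mathcal C\mathcal V_2^*\end{bmatrix}$$ be a CS-decomposition, with $\mathcal U_1,\mathcal U_2,\mathcal V_1,\mathcal V_2\in\mathbb C^{L\times L}$ unitary and $\mathcal C=\operatorname{diag}(c_1,\dots,c_L)$, $\mathcal S=\operatorname{diag}(s_1,\dots,s_L)$ real with $s_i^2+c_i^2=1$, and let $\mathcal Q$ be the unitary matrix with $\mathcal V_1=\widehat M_j\mathcal Q$. **Theorem.** If $H_j^{(B)}$ is nonsingular, then $X_j^{(F)}$, $X_j^{(G)}$, $X_{j-1}^{(G)}$ exist and are unique, $\widehat C_j$ is nonsingular, and $$X_j^{(G)}=X_j^{(F)}\left(\widehat C_j^{-1}\mathcal Q\,\mathcal C^2\mathcal Q^*\widehat C_j\right)+X_{j-1}^{(G)}\left(\widehat C_j^{-1}\mathcal Q\,\mathcal S^2\mathcal Q^*\widehat C_j\right).$$ -/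

import Mathlib

open scoped Matrix

noncomputable section

namespace BlockKrylov

/-! Block matrices have rows and columns indexed by `Fin m × Fin L` (block number, position in the
block).  Blocks are numbered from `0`: `V i`, `H i l`, `Ω i` below are the
objects usually written `V_{i+1}`, `H_{i+1,l+1}` and the `(i+1)`-st orthogonal transformation. -/

variable {n L : ℕ}

/-- The block Krylov subspace: the span of all columns of `F, A F, …, A ^ (j - 1) F`. -/
def blockKrylov (A : Matrix (Fin n) (Fin n) ℂ) (F : Matrix (Fin n) (Fin L) ℂ) (j : ℕ) :
    Submodule ℂ (Fin n → ℂ) :=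
  Submodule.span ℂ {v | ∃ i < j, ∃ c : Fin L, v = (A ^ i * F).col c}

/-- `X` is a `j`-th block FOM approximation for `A X = B` with initial guess `X₀`: each column of
the correction lies in the `j`-th block Krylov subspace and each column of the residual is
orthogonal to that subspace. -/
def IsBlockFOM (A : Matrix (Fin n) (Fin n) ℂ) (B X₀ : Matrix (Fin n) (Fin L) ℂ) (j : ℕ)
    (X : Matrix (Fin n) (Fin L) ℂ) : Prop :=
  ∀ c : Fin L, (X - X₀).col c ∈ blockKrylov A (B - A * X₀) j ∧
    ∀ v ∈ blockKrylov A (B - A * X₀) j, star v ⬝ᵥ (B - A * X).col c = 0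

/-- `X` is a `j`-th block GMRES approximation: each column of the correction lies in the `j`-th
block Krylov subspace `K` and each column of the residual is orthogonal to `A K`. -/
def IsBlockGMRES (A : Matrix (Fin n) (Fin n) ℂ) (B X₀ : Matrix (Fin n) (Fin L) ℂ) (j : ℕ)
    (X : Matrix (Fin n) (Fin L) ℂ) : Prop :=
  ∀ c : Fin L, (X - X₀).col c ∈ blockKrylov A (B - A * X₀) j ∧
    ∀ v ∈ blockKrylov A (B - A * X₀) j, star (A *ᵥ v) ⬝ᵥ (B - A * X).col c = 0

/-- The matrix with blocks `H a b`, with `p` block rows and `q` block columns. -/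
def blockMatrix (p q : ℕ) (H : ℕ → ℕ → Matrix (Fin L) (Fin L) ℂ) :
    Matrix (Fin p × Fin L) (Fin q × Fin L) ℂ :=
  Matrix.of fun a b => H a.1 b.1 a.2 b.2

/-- The matrix `W = [V 0, …, V (m - 1)]`. -/
def blockRow (m : ℕ) (V : ℕ → Matrix (Fin n) (Fin L) ℂ) : Matrix (Fin n) (Fin m × Fin L) ℂ :=
  Matrix.of fun r b => V b.1 r b.2

/-- The first `L` columns of the identity matrix with `m * L` rows. -/
def firstBlock (m : ℕ) : Matrix (Fin m × Fin L) (Fin L) ℂ :=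
  Matrix.of fun a c => if (a.1 : ℕ) = 0 ∧ a.2 = c then 1 else 0

/-- The result of `j` steps of the block Arnoldi process: the columns of `W = [V 0, …, V j]` are
orthonormal, `F = V 0 * S` is a reduced QR factorization, and `A [V 0, …, V (j-1)] = W * H` with
`H` block upper Hessenberg and upper triangular subdiagonal blocks. -/
structure IsBlockArnoldi (A : Matrix (Fin n) (Fin n) ℂ) (F : Matrix (Fin n) (Fin L) ℂ) (j : ℕ)
    (V : ℕ → Matrix (Fin n) (Fin L) ℂ) (H : ℕ → ℕ → Matrix (Fin L) (Fin L) ℂ)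
    (S : Matrix (Fin L) (Fin L) ℂ) : Prop where
  orthonormal : (blockRow (j + 1) V)ᴴ * blockRow (j + 1) V = 1
  start : F = V 0 * S
  start_upper : S.BlockTriangular id
  relation : A * blockRow j V = blockRow (j + 1) V * blockMatrix (j + 1) j H
  hessenberg : ∀ i l, l < j → l + 1 < i → i ≤ j → H i l = 0
  subdiag_upper : ∀ l < j, (H (l + 1) l).BlockTriangular id

/-- The transformation of `m` block rows that acts by the `2L × 2L` matrix `Ω` on the block rows
`i` and `i + 1` and is the identity elsewhere. -/
def embedPair (m i : ℕ) (Ω : Matrix (Fin L ⊕ Fin L) (Fin L ⊕ Fin L) ℂ) :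
    Matrix (Fin m × Fin L) (Fin m × Fin L) ℂ :=
  blockMatrix m m fun a b =>
    if a = i ∧ b = i then Ω.toBlocks₁₁
    else if a = i ∧ b = i + 1 then Ω.toBlocks₁₂
    else if a = i + 1 ∧ b = i then Ω.toBlocks₂₁
    else if a = i + 1 ∧ b = i + 1 then Ω.toBlocks₂₂
    else if a = b then 1 else 0

/-- The transformation of `m` block rows that acts by the `L × L` matrix `P` on the block row `i`
and is the identity elsewhere. -/
def embedSingle (m i : ℕ) (P : Matrix (Fin L) (Fin L) ℂ) :
    Matrix (Fin m × Fin L) (Fin m × Fin L) ℂ :=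
  blockMatrix m m fun a b => if a = i ∧ b = i then P else if a = b then 1 else 0

/-- The product of the first `t` transformations, the one with index `t - 1` leftmost, acting on
`m` block rows. -/
def transProd (m : ℕ) (Ω : ℕ → Matrix (Fin L ⊕ Fin L) (Fin L ⊕ Fin L) ℂ) :
    ℕ → Matrix (Fin m × Fin L) (Fin m × Fin L) ℂ
  | 0 => 1
  | t + 1 => embedPair m t (Ω t) * transProd m Ω t

/-- The unitary `2L × 2L` transformations `Ω 0, …, Ω (j - 1)` compute a QR factorization of the
block Hessenberg matrix with `j + 1` block rows and `j` block columns: the transformation with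
index `i` annihilates all subdiagonal entries of the block column `i`. -/
structure IsHessenbergQR (j : ℕ) (H : ℕ → ℕ → Matrix (Fin L) (Fin L) ℂ)
    (Ω : ℕ → Matrix (Fin L ⊕ Fin L) (Fin L ⊕ Fin L) ℂ) : Prop where
  unitary : ∀ i < j, Ω i ∈ Matrix.unitaryGroup (Fin L ⊕ Fin L) ℂ
  annihilates : ∀ (i : Fin j) (a : Fin (j + 1)) (r c : Fin L),
    ((i : ℕ) < a ∨ ((i : ℕ) = a ∧ c < r)) →
      (transProd (j + 1) Ω (i + 1) * blockMatrix (j + 1) j H) (a, r) (i, c) = 0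

/-- The last diagonal block of the square block Hessenberg matrix (with `k + 1` block rows and
columns) after the first `k` transformations. -/
def hatH (k : ℕ) (H : ℕ → ℕ → Matrix (Fin L) (Fin L) ℂ)
    (Ω : ℕ → Matrix (Fin L ⊕ Fin L) (Fin L ⊕ Fin L) ℂ) : Matrix (Fin L) (Fin L) ℂ :=
  (transProd (k + 1) Ω k * blockMatrix (k + 1) (k + 1) H).submatrix
    (fun r => (Fin.last k, r)) (fun c => (Fin.last k, c))

/-- The last block of the transformed right-hand side of the block FOM system at step `k + 1`,
where `P` is the unitary factor that triangularizes the last diagonal block. -/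
def hatC (k : ℕ) (Ω : ℕ → Matrix (Fin L ⊕ Fin L) (Fin L ⊕ Fin L) ℂ)
    (P S : Matrix (Fin L) (Fin L) ℂ) : Matrix (Fin L) (Fin L) ℂ :=
  (embedSingle (k + 1) k P * transProd (k + 1) Ω k * (firstBlock (L := L) (k + 1) * S)).submatrix
    (fun r => (Fin.last k, r)) id

/-- A real diagonal matrix, as a complex matrix. -/
def realDiag (c : Fin L → ℝ) : Matrix (Fin L) (Fin L) ℂ :=
  Matrix.diagonal fun i => (c i : ℂ)

/-- A CS-decomposition of a `2L × 2L` matrix with cosines `c` and sines `s`. -/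
structure IsCSDecomposition (Ω : Matrix (Fin L ⊕ Fin L) (Fin L ⊕ Fin L) ℂ)
    (U₁ U₂ V₁ V₂ : Matrix (Fin L) (Fin L) ℂ) (c s : Fin L → ℝ) : Prop where
  unitary_U₁ : U₁ ∈ Matrix.unitaryGroup (Fin L) ℂ
  unitary_U₂ : U₂ ∈ Matrix.unitaryGroup (Fin L) ℂ
  unitary_V₁ : V₁ ∈ Matrix.unitaryGroup (Fin L) ℂ
  unitary_V₂ : V₂ ∈ Matrix.unitaryGroup (Fin L) ℂ
  sq_add_sq : ∀ i, s i ^ 2 + c i ^ 2 = 1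
  block₁₁ : Ω.toBlocks₁₁ = U₁ * realDiag c * V₁ᴴ
  block₁₂ : Ω.toBlocks₁₂ = U₁ * realDiag s * V₂ᴴ
  block₂₁ : Ω.toBlocks₂₁ = U₂ * realDiag s * V₁ᴴ
  block₂₂ : Ω.toBlocks₂₂ = -(U₂ * realDiag c * V₂ᴴ)

end BlockKrylov

end

open Matrix

namespace BlockKrylov

/-! ### Projection conditions as matrix equations -/

section Characterizations

variable {n L j : ℕ} {ι κ : Type*} [Fintype ι] [Fintype κ]

/-! Let Θ be the product of the first k transformations and P = [P₁ P₂] = W Θᴴ, a second orthonormal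
basis of the (k+1)-st Krylov space. Since Θ H is block upper triangular with diagonal blocks R and T
= `hatH`, one has A W₁ = P₁ R and A V_k = P₁ g + P₂ T + P' h, where P' is the next Arnoldi block and
h the last subdiagonal block. Write F₀ = P₁ f + P₂ C. Then the previous GMRES residual is P₂ C, and
the FOM residual is -P' h T⁻¹ C.

A combination XF Dc + XG' Ds with Dc + Ds = 1 has its correction in the Krylov space and combines
the residuals in the same way. These are already orthogonal to P₁, so the GMRES condition reduces to
the single L × L equation hᴴ h T⁻¹ C Dc = Tᴴ C Ds (`blockGMRES_eq_of_blockTriangular`).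

The last transformation annihilates h, so T = aᴴ R' and h = bᴴ R', where [a b] is its first block
row (`toBlocks_factor`). The equation then follows from aᴴ a C = C Dc (`residual_balance`). As C = M
Ĉ and aᴴ a = M 𝒬 𝒞² 𝒬ᴴ Mᴴ, this gives Dc = Ĉ⁻¹ 𝒬 𝒞² 𝒬ᴴ Ĉ. The invertibility of Ĉ comes from the
dimension count in `IsBlockArnoldi.blockKrylov_eq`. -/

theorem forall_col_mem_range_iff (W : Matrix (Fin n) ι ℂ) (X : Matrix (Fin n) (Fin L) ℂ) :
    (∀ c, X.col c ∈ LinearMap.range W.mulVecLin) ↔ ∃ Y : Matrix ι (Fin L) ℂ, X = W * Y := by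
  constructor
  · intro h
    choose y hy using h
    refine ⟨Matrix.of fun i c => y c i, ?_⟩
    ext r c
    have := congrFun (hy c) r
    simpa [Matrix.mul_apply, Matrix.mulVec, dotProduct] using this.symm
  · rintro ⟨Y, rfl⟩ c
    exact ⟨Y.col c, by ext r; simp [Matrix.mul_apply, Matrix.mulVec, dotProduct]⟩

theorem forall_orthogonal_col_iff (A : Matrix (Fin n) (Fin n) ℂ) (W : Matrix (Fin n) ι ℂ)
    (R : Matrix (Fin n) (Fin L) ℂ) :
    (∀ c, ∀ v ∈ LinearMap.range W.mulVecLin, star (A *ᵥ v) ⬝ᵥ R.col c = 0) ↔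
      (A * W)ᴴ * R = 0 := by
  classical
  have key : ∀ (x : ι → ℂ) (c : Fin L),
      star (A *ᵥ (W *ᵥ x)) ⬝ᵥ R.col c = star x ⬝ᵥ ((A * W)ᴴ * R).col c := by
    intro x c
    have : ((A * W)ᴴ * R).col c = (A * W)ᴴ *ᵥ R.col c := by
      rfl
    rw [this, Matrix.mulVec_mulVec, Matrix.star_mulVec, Matrix.dotProduct_mulVec]
  constructor
  · intro h
    ext i c
    have := h c (W *ᵥ Pi.single i 1) ⟨_, rfl⟩
    rw [key] at this
    simpa [← Pi.single_star] using this
  · rintro h c _ ⟨x, rfl⟩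
    rw [Matrix.mulVecLin_apply, key, h]
    exact dotProduct_zero _

/-- Two spanning matrices are allowed because corrections are expanded in the Arnoldi basis `W`,
while residuals are tested against the rotated basis `P`. -/
theorem isBlockFOM_iff {A : Matrix (Fin n) (Fin n) ℂ} {B X₀ : Matrix (Fin n) (Fin L) ℂ}
    {W : Matrix (Fin n) ι ℂ} {P : Matrix (Fin n) κ ℂ}
    (hW : blockKrylov A (B - A * X₀) j = LinearMap.range W.mulVecLin)
    (hP : blockKrylov A (B - A * X₀) j = LinearMap.range P.mulVecLin)
    (X : Matrix (Fin n) (Fin L) ℂ) :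
    IsBlockFOM A B X₀ j X ↔ (∃ Y : Matrix ι (Fin L) ℂ, X - X₀ = W * Y) ∧ Pᴴ * (B - A * X) = 0 := by
  have h := forall_orthogonal_col_iff 1 P (B - A * X)
  simp only [Matrix.one_mulVec, Matrix.one_mul] at h
  rw [← forall_col_mem_range_iff, ← h, ← hW, ← hP]
  exact forall_and

theorem isBlockGMRES_iff {A : Matrix (Fin n) (Fin n) ℂ} {B X₀ : Matrix (Fin n) (Fin L) ℂ}
    {W : Matrix (Fin n) ι ℂ}
    (hW : blockKrylov A (B - A * X₀) j = LinearMap.range W.mulVecLin)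
    (X : Matrix (Fin n) (Fin L) ℂ) :
    IsBlockGMRES A B X₀ j X ↔ (∃ Y : Matrix ι (Fin L) ℂ, X - X₀ = W * Y) ∧ (A * W)ᴴ * (B - A * X) = 0 := by
  rw [← forall_col_mem_range_iff, ← forall_orthogonal_col_iff, ← hW]
  exact forall_and

end Characterizations

/-! ### The coupling identity in a block triangular basis -/

section Core

variable {n L k : ℕ} {ι : Type*} [Fintype ι] [DecidableEq ι]
  {A : Matrix (Fin n) (Fin n) ℂ} {B X₀ : Matrix (Fin n) (Fin L) ℂ}

/-- If `A W = P N + P' E` with orthonormal columns of `[P, P']`, `B - A X₀ = P G` and `N`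
nonsingular, then the block FOM approximation is `X₀ + W N⁻¹ G`. -/
theorem isBlockFOM_iff_eq {W P : Matrix (Fin n) ι ℂ} {P' : Matrix (Fin n) (Fin L) ℂ}
    {N : Matrix ι ι ℂ} {E : Matrix (Fin L) ι ℂ} {G : Matrix ι (Fin L) ℂ}
    (hW : blockKrylov A (B - A * X₀) k = LinearMap.range W.mulVecLin)
    (hP : blockKrylov A (B - A * X₀) k = LinearMap.range P.mulVecLin)
    (hPP : Pᴴ * P = 1) (hPP' : Pᴴ * P' = 0)
    (hAW : A * W = P * N + P' * E) (hF : B - A * X₀ = P * G) (hN : IsUnit N.det)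
    (X : Matrix (Fin n) (Fin L) ℂ) :
    IsBlockFOM A B X₀ k X ↔ X = X₀ + W * (N⁻¹ * G) := by
  have res : ∀ Y : Matrix ι (Fin L) ℂ, Pᴴ * (B - A * (X₀ + W * Y)) = G - N * Y := by
    intro Y
    have : B - A * (X₀ + W * Y) = (B - A * X₀) - (A * W) * Y := by
      rw [Matrix.mul_add, Matrix.mul_assoc]; abel
    rw [this, hF, hAW, Matrix.mul_sub, Matrix.add_mul, Matrix.mul_add]
    simp only [← Matrix.mul_assoc, hPP, hPP']
    simp
  rw [isBlockFOM_iff hW hP]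
  constructor
  · rintro ⟨⟨Y, hY⟩, h⟩
    obtain rfl : X = X₀ + W * Y := by rw [← hY]; abel
    rw [res, sub_eq_zero] at h
    rw [h, Matrix.nonsing_inv_mul_cancel_left _ _ hN]
  · rintro rfl
    refine ⟨⟨_, add_sub_cancel_left _ _⟩, ?_⟩
    rw [res, Matrix.mul_nonsing_inv_cancel_left _ _ hN, sub_self]

/-- If `A W = Z` and `Zᴴ Z` is nonsingular, then the block GMRES approximation is determined by
the normal equations. -/
theorem isBlockGMRES_iff_eq {W : Matrix (Fin n) ι ℂ}
    (hW : blockKrylov A (B - A * X₀) k = LinearMap.range W.mulVecLin)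
    (hN : IsUnit ((A * W)ᴴ * (A * W)).det) (X : Matrix (Fin n) (Fin L) ℂ) :
    IsBlockGMRES A B X₀ k X ↔
      X = X₀ + W * (((A * W)ᴴ * (A * W))⁻¹ * ((A * W)ᴴ * (B - A * X₀))) := by
  have res : ∀ Y : Matrix ι (Fin L) ℂ, (A * W)ᴴ * (B - A * (X₀ + W * Y)) =
      (A * W)ᴴ * (B - A * X₀) - ((A * W)ᴴ * (A * W)) * Y := by
    intro Y
    have : B - A * (X₀ + W * Y) = (B - A * X₀) - (A * W) * Y := by
      rw [Matrix.mul_add, Matrix.mul_assoc]; abel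
    rw [this, Matrix.mul_sub, Matrix.mul_assoc (A * W)ᴴ]
  rw [isBlockGMRES_iff hW]
  constructor
  · rintro ⟨⟨Y, hY⟩, h⟩
    obtain rfl : X = X₀ + W * Y := by rw [← hY]; abel
    rw [res, sub_eq_zero] at h
    rw [h, Matrix.nonsing_inv_mul_cancel_left _ _ hN]
  · rintro rfl
    refine ⟨⟨_, add_sub_cancel_left _ _⟩, ?_⟩
    rw [res, Matrix.mul_nonsing_inv_cancel_left _ _ hN, sub_self]

theorem isUnit_det_gram_of_mulVec_injective {κ : Type*} [Fintype κ] {Z : Matrix κ ι ℂ}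
    (hZ : Function.Injective Z.mulVec) : IsUnit (Zᴴ * Z).det := by
  rw [← Matrix.isUnit_iff_isUnit_det]
  open scoped ComplexOrder in
  exact (Matrix.PosDef.conjTranspose_mul_self Z hZ).isUnit

theorem mulVec_injective_of_mul_eq {ι κ κ' : Type*} [Fintype ι] [Fintype κ] [Fintype κ'] {Q : Matrix κ' κ ℂ}
    {Z : Matrix κ ι ℂ} {T : Matrix κ' ι ℂ} (h : Q * Z = T)
    (hT : Function.Injective T.mulVec) : Function.Injective Z.mulVec := by
  intro x y hxy
  apply hT
  rw [← h, ← Matrix.mulVec_mulVec, ← Matrix.mulVec_mulVec]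
  exact congrArg _ hxy

/-- The coupling identity between block FOM and block GMRES in a basis in which the projected
matrix is block upper triangular. -/
theorem blockGMRES_eq_of_blockTriangular {W₁ P₁ : Matrix (Fin n) ι ℂ}
    {W₂ P₂ P' : Matrix (Fin n) (Fin L) ℂ} {R : Matrix ι ι ℂ} {g : Matrix ι (Fin L) ℂ}
    {T h : Matrix (Fin L) (Fin L) ℂ} {f : Matrix ι (Fin L) ℂ} {C : Matrix (Fin L) (Fin L) ℂ}
    (hW₁ : blockKrylov A (B - A * X₀) k = LinearMap.range W₁.mulVecLin)
    (hW : blockKrylov A (B - A * X₀) (k + 1) = LinearMap.range (fromCols W₁ W₂).mulVecLin)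
    (hP : blockKrylov A (B - A * X₀) (k + 1) = LinearMap.range (fromCols P₁ P₂).mulVecLin)
    (h₁₁ : P₁ᴴ * P₁ = 1) (h₁₂ : P₁ᴴ * P₂ = 0) (h₂₁ : P₂ᴴ * P₁ = 0) (h₂₂ : P₂ᴴ * P₂ = 1)
    (h₁₃ : P₁ᴴ * P' = 0) (h₂₃ : P₂ᴴ * P' = 0) (h₃₂ : P'ᴴ * P₂ = 0)
    (h₃₃ : P'ᴴ * P' = 1)
    (hA₁ : A * W₁ = P₁ * R) (hA₂ : A * W₂ = P₁ * g + P₂ * T + P' * h)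
    (hF : B - A * X₀ = P₁ * f + P₂ * C) (hR : IsUnit R.det) (hT : IsUnit T.det) :
    (∃! X, IsBlockFOM A B X₀ (k + 1) X) ∧ (∃! X, IsBlockGMRES A B X₀ (k + 1) X) ∧
    (∃! X, IsBlockGMRES A B X₀ k X) ∧
    ∀ XF XG XG' : Matrix (Fin n) (Fin L) ℂ, IsBlockFOM A B X₀ (k + 1) XF →
      IsBlockGMRES A B X₀ (k + 1) XG → IsBlockGMRES A B X₀ k XG' →
      ∀ Dc Ds : Matrix (Fin L) (Fin L) ℂ, Dc + Ds = 1 →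
        hᴴ * h * (T⁻¹ * C) * Dc = Tᴴ * C * Ds → XG = XF * Dc + XG' * Ds := by
  set W := fromCols W₁ W₂ with hWdef
  have hPP : (fromCols P₁ P₂)ᴴ * fromCols P₁ P₂ = 1 := by
    rw [conjTranspose_fromCols_eq_fromRows_conjTranspose, fromRows_mul_fromCols,
      h₁₁, h₁₂, h₂₁, h₂₂, fromBlocks_one]
  have hPP' : (fromCols P₁ P₂)ᴴ * P' = 0 := by
    rw [conjTranspose_fromCols_eq_fromRows_conjTranspose, fromRows_mul, h₁₃, h₂₃, fromRows_zero]
  have hAW : A * W = fromCols P₁ P₂ * fromBlocks R g 0 T + P' * fromCols 0 h := by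
    rw [hWdef, mul_fromCols, hA₁, hA₂, fromCols_mul_fromBlocks, mul_fromCols]
    ext i (j | j) <;> simp
  have hN : IsUnit (fromBlocks R g 0 T).det := by
    rw [det_fromBlocks_zero₂₁]
    exact hR.mul hT
  -- Compressing by the orthonormal columns leaves the nonsingular triangular matrix, so `A * W` has
  -- full column rank even if `A` is singular.
  have hAWinj : Function.Injective (A * W).mulVec := by
    refine mulVec_injective_of_mul_eq (Q := (fromCols P₁ P₂)ᴴ) (T := fromBlocks R g 0 T) ?_
      (mulVec_injective_iff_isUnit.2 ((isUnit_iff_isUnit_det _).2 hN))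
    rw [hAW, Matrix.mul_add, ← Matrix.mul_assoc, ← Matrix.mul_assoc, hPP, hPP']
    simp
  have hAW₁inj : Function.Injective (A * W₁).mulVec := by
    refine mulVec_injective_of_mul_eq (Q := P₁ᴴ) (T := R) ?_
      (mulVec_injective_iff_isUnit.2 ((isUnit_iff_isUnit_det _).2 hR))
    rw [hA₁, ← Matrix.mul_assoc, h₁₁, Matrix.one_mul]
  have hF' : B - A * X₀ = fromCols P₁ P₂ * fromRows f C := by
    rw [fromCols_mul_fromRows, hF]
  have uF := isBlockFOM_iff_eq hW hP hPP hPP' hAW hF' hN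
  have uG := isBlockGMRES_iff_eq hW (isUnit_det_gram_of_mulVec_injective hAWinj)
  have uG' := isBlockGMRES_iff_eq hW₁ (isUnit_det_gram_of_mulVec_injective hAW₁inj)
  refine ⟨⟨_, (uF _).2 rfl, fun y => (uF y).1⟩, ⟨_, (uG _).2 rfl, fun y => (uG y).1⟩,
    ⟨_, (uG' _).2 rfl, fun y => (uG' y).1⟩, ?_⟩
  intro XF XG XG' hXF hXG hXG' Dc Ds hD hbal
  have rF : B - A * XF = -(P' * (h * (T⁻¹ * C))) := by
    -- The coefficients come from block back substitution; only the component along `P'` survives in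
    -- the residual.
    have hX : IsBlockFOM A B X₀ (k + 1)
        (X₀ + W * fromRows (R⁻¹ * (f - g * (T⁻¹ * C))) (T⁻¹ * C)) ∧
        B - A * (X₀ + W * fromRows (R⁻¹ * (f - g * (T⁻¹ * C))) (T⁻¹ * C)) =
          -(P' * (h * (T⁻¹ * C))) := by
      have r : B - A * (X₀ + W * fromRows (R⁻¹ * (f - g * (T⁻¹ * C))) (T⁻¹ * C)) =
          -(P' * (h * (T⁻¹ * C))) := by
        have : B - A * (X₀ + W * fromRows (R⁻¹ * (f - g * (T⁻¹ * C))) (T⁻¹ * C)) =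
            (B - A * X₀) - (A * W₁) * (R⁻¹ * (f - g * (T⁻¹ * C))) -
              (A * W₂) * (T⁻¹ * C) := by
          rw [hWdef, fromCols_mul_fromRows, Matrix.mul_add, Matrix.mul_add, Matrix.mul_assoc,
            Matrix.mul_assoc]
          abel
        rw [this, hF, hA₁, hA₂, Matrix.mul_assoc P₁ R, mul_nonsing_inv_cancel_left _ _ hR,
          Matrix.add_mul, Matrix.add_mul, Matrix.mul_assoc P₂ T,
          mul_nonsing_inv_cancel_left _ _ hT, Matrix.mul_sub, Matrix.mul_assoc P₁ g,
          Matrix.mul_assoc P' h]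
        abel
      refine ⟨(isBlockFOM_iff hW hP _).2 ⟨⟨_, add_sub_cancel_left _ _⟩, ?_⟩, r⟩
      rw [r, Matrix.mul_neg, ← Matrix.mul_assoc, hPP', Matrix.zero_mul, neg_zero]
    rw [(uF _).1 hXF, ← (uF _).1 hX.1, hX.2]
  have rG' : B - A * XG' = P₂ * C := by
    have r : B - A * (X₀ + W₁ * (R⁻¹ * f)) = P₂ * C := by
      have : B - A * (X₀ + W₁ * (R⁻¹ * f)) = (B - A * X₀) - (A * W₁) * (R⁻¹ * f) := by
        rw [Matrix.mul_add, Matrix.mul_assoc]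
        abel
      rw [this, hF, hA₁, Matrix.mul_assoc P₁ R, mul_nonsing_inv_cancel_left _ _ hR]
      abel
    have hX : IsBlockGMRES A B X₀ k (X₀ + W₁ * (R⁻¹ * f)) := by
      refine (isBlockGMRES_iff hW₁ _).2 ⟨⟨_, add_sub_cancel_left _ _⟩, ?_⟩
      rw [r, hA₁, conjTranspose_mul, Matrix.mul_assoc, ← Matrix.mul_assoc P₁ᴴ, h₁₂,
        Matrix.zero_mul, Matrix.mul_zero]
    rw [(uG' _).1 hXG', ← (uG' _).1 hX, r]
  obtain ⟨⟨YF, hYF⟩, -⟩ := (isBlockFOM_iff hW hP _).1 hXF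
  obtain ⟨⟨YG, hYG⟩, -⟩ := (isBlockGMRES_iff hW₁ _).1 hXG'
  -- By uniqueness it suffices that the combination satisfies the GMRES conditions.
  rw [(uG _).1 hXG]
  symm
  rw [← uG, isBlockGMRES_iff hW]
  constructor
  · refine ⟨YF * Dc + fromRows (YG * Ds) 0, ?_⟩
    have : XF * Dc + XG' * Ds - X₀ = (XF - X₀) * Dc + (XG' - X₀) * Ds := by
      have h0 : X₀ = X₀ * Dc + X₀ * Ds := by rw [← Matrix.mul_add, hD, Matrix.mul_one]
      nth_rewrite 1 [h0]
      rw [Matrix.sub_mul, Matrix.sub_mul]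
      abel
    rw [this, hYF, hYG, Matrix.mul_add, Matrix.mul_assoc, hWdef, fromCols_mul_fromRows,
      Matrix.mul_zero, add_zero, Matrix.mul_assoc]
  · have : B - A * (XF * Dc + XG' * Ds) = (B - A * XF) * Dc + (B - A * XG') * Ds := by
      have h0 : B = B * Dc + B * Ds := by rw [← Matrix.mul_add, hD, Matrix.mul_one]
      nth_rewrite 1 [h0]
      rw [Matrix.sub_mul, Matrix.sub_mul, Matrix.mul_add, Matrix.mul_assoc, Matrix.mul_assoc]
      abel
    rw [this, rF, rG', hWdef, mul_fromCols, conjTranspose_fromCols_eq_fromRows_conjTranspose,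
      fromRows_mul, hA₁, hA₂]
    -- Testing against `A * W₁` is automatic; the balance equation is needed only for `A * W₂`.
    have e₁ : (P₁ * R)ᴴ * (-(P' * (h * (T⁻¹ * C))) * Dc + P₂ * C * Ds) = 0 := by
      rw [conjTranspose_mul, Matrix.mul_assoc, Matrix.mul_add, Matrix.neg_mul, Matrix.mul_neg]
      simp only [← Matrix.mul_assoc, h₁₂, h₁₃]
      simp
    have e₂ : (P₁ * g + P₂ * T + P' * h)ᴴ *
        (-(P' * (h * (T⁻¹ * C))) * Dc + P₂ * C * Ds) = 0 := by
      have o₁ : P₁ᴴ * (-(P' * (h * (T⁻¹ * C))) * Dc + P₂ * C * Ds) = 0 := by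
        rw [Matrix.mul_add, Matrix.neg_mul, Matrix.mul_neg]
        simp only [← Matrix.mul_assoc, h₁₂, h₁₃]
        simp
      have o₂ : P₂ᴴ * (-(P' * (h * (T⁻¹ * C))) * Dc + P₂ * C * Ds) = C * Ds := by
        rw [Matrix.mul_add, Matrix.neg_mul, Matrix.mul_neg]
        simp only [← Matrix.mul_assoc, h₂₂, h₂₃]
        simp
      have o₃ : P'ᴴ * (-(P' * (h * (T⁻¹ * C))) * Dc + P₂ * C * Ds) =
          -(h * (T⁻¹ * C) * Dc) := by
        rw [Matrix.mul_add, Matrix.neg_mul, Matrix.mul_neg]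
        simp only [← Matrix.mul_assoc, h₃₂, h₃₃]
        simp
      rw [conjTranspose_add, conjTranspose_add, conjTranspose_mul, conjTranspose_mul,
        conjTranspose_mul, Matrix.add_mul, Matrix.add_mul, Matrix.mul_assoc gᴴ,
        Matrix.mul_assoc Tᴴ, Matrix.mul_assoc hᴴ, o₁, o₂, o₃, Matrix.mul_neg, ← Matrix.mul_assoc, ← Matrix.mul_assoc,
        ← Matrix.mul_assoc, ← hbal]
      simp [Matrix.mul_assoc]
    rw [e₁, e₂, fromRows_zero]

/-- Since `T = aᴴ * R` is invertible, `R * T⁻¹` inverts `aᴴ` and cancels the factor `aᴴ` in `C * D =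
aᴴ * a * C`. What remains is Rᴴ b bᴴ a C = Rᴴ (1 - a aᴴ) a C = Rᴴ a (C - C D) = Tᴴ C D'. -/
theorem residual_balance {T h C a b R D D' : Matrix (Fin L) (Fin L) ℂ}
    (hT : IsUnit T.det) (hTa : T = aᴴ * R) (hh : h = bᴴ * R) (hab : a * aᴴ + b * bᴴ = 1)
    (hD : aᴴ * a * C = C * D) (hDD : D + D' = 1) :
    hᴴ * h * (T⁻¹ * C) * D = Tᴴ * C * D' := by
  have h1 : R * T⁻¹ * aᴴ = 1 := by
    have : aᴴ * (R * T⁻¹) = 1 := by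
      rw [← Matrix.mul_assoc, ← hTa, Matrix.mul_nonsing_inv _ hT]
    exact mul_eq_one_comm.mp this
  have hb : b * bᴴ = 1 - a * aᴴ := by rw [← hab]; abel
  have hD' : D' = 1 - D := by rw [← hDD]; abel
  calc hᴴ * h * (T⁻¹ * C) * D = Rᴴ * (b * bᴴ) * (R * T⁻¹) * (C * D) := by
        rw [hh]; simp [Matrix.mul_assoc]
    _ = Rᴴ * (b * bᴴ) * (R * T⁻¹ * aᴴ) * (a * C) := by
        rw [← hD]; simp only [Matrix.mul_assoc]
    _ = Rᴴ * (a * C - a * (aᴴ * a * C)) := by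
        rw [h1, hb]; simp [Matrix.mul_assoc, Matrix.mul_sub, Matrix.sub_mul]
    _ = Tᴴ * C * D' := by
        rw [hD, hTa, hD']; simp [Matrix.mul_assoc, Matrix.mul_sub]

end Core

/-! ### Block rows and the embedded transformations -/

section BlockRows

variable {L m : ℕ} {γ : Type*}

/-- The block row with number `a` of a matrix. -/
def rowBlock (N : Matrix (Fin m × Fin L) γ ℂ) (a : Fin m) : Matrix (Fin L) γ ℂ :=
  N.submatrix (fun r => (a, r)) id

theorem rowBlock_ext {N N' : Matrix (Fin m × Fin L) γ ℂ}
    (h : ∀ a, rowBlock N a = rowBlock N' a) : N = N' := by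
  ext ⟨a, r⟩ c
  exact congrFun (congrFun (h a) r) c

theorem rowBlock_blockMatrix_mul (p : ℕ) (H : ℕ → ℕ → Matrix (Fin L) (Fin L) ℂ)
    (N : Matrix (Fin m × Fin L) γ ℂ) (a : Fin p) :
    rowBlock (blockMatrix p m H * N) a = ∑ b : Fin m, H a b * rowBlock N b := by
  ext r c
  rw [Matrix.sum_apply]
  simp [rowBlock, blockMatrix, Matrix.mul_apply, Fintype.sum_prod_type]

theorem rowBlock_embedSingle_mul (i : Fin m) (P : Matrix (Fin L) (Fin L) ℂ)
    (N : Matrix (Fin m × Fin L) γ ℂ) :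
    rowBlock (embedSingle m i P * N) i = P * rowBlock N i := by
  rw [embedSingle, rowBlock_blockMatrix_mul, Finset.sum_eq_single i]
  · simp
  · intro b _ hb
    have : (b : ℕ) ≠ i := fun h => hb (Fin.ext h)
    simp [this, this.symm]
  · simp

variable (Ω : Matrix (Fin L ⊕ Fin L) (Fin L ⊕ Fin L) ℂ)

theorem rowBlock_embedPair_mul_of_ne {i : ℕ} {a : Fin m} (h : (a : ℕ) ≠ i) (h' : (a : ℕ) ≠ i + 1)
    (N : Matrix (Fin m × Fin L) γ ℂ) :
    rowBlock (embedPair m i Ω * N) a = rowBlock N a := by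
  rw [embedPair, rowBlock_blockMatrix_mul, Finset.sum_eq_single a]
  · simp [h, h']
  · intro b _ hb
    have : (a : ℕ) ≠ b := fun h => hb (Fin.ext h.symm)
    simp [h, h', this]
  · simp

theorem rowBlock_embedPair_mul_fst {i j : Fin m} (hij : (j : ℕ) = i + 1)
    (N : Matrix (Fin m × Fin L) γ ℂ) :
    rowBlock (embedPair m i Ω * N) i =
      Ω.toBlocks₁₁ * rowBlock N i + Ω.toBlocks₁₂ * rowBlock N j := by
  rw [embedPair, rowBlock_blockMatrix_mul, Finset.sum_eq_add i j]
  · simp [hij]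
  · rintro rfl; omega
  · rintro b - ⟨h1, h2⟩
    have e1 : (b : ℕ) ≠ i := fun h => h1 (Fin.ext h)
    have e2 : (b : ℕ) ≠ i + 1 := fun h => h2 (Fin.ext (h.trans hij.symm))
    simp [e1, e2, e1.symm]
  · simp
  · simp

theorem rowBlock_embedPair_mul_snd {i j : Fin m} (hij : (j : ℕ) = i + 1)
    (N : Matrix (Fin m × Fin L) γ ℂ) :
    rowBlock (embedPair m i Ω * N) j =
      Ω.toBlocks₂₁ * rowBlock N i + Ω.toBlocks₂₂ * rowBlock N j := by
  rw [embedPair, rowBlock_blockMatrix_mul, Finset.sum_eq_add i j]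
  · simp [hij]
  · rintro rfl; omega
  · rintro b - ⟨h1, h2⟩
    have e1 : (b : ℕ) ≠ i := fun h => h1 (Fin.ext h)
    have e2 : (b : ℕ) ≠ i + 1 := fun h => h2 (Fin.ext (h.trans hij.symm))
    have e3 : ¬ ((i : ℕ) + 1 = b) := fun h => e2 h.symm
    simp [e1, e2, e3, hij]
  · simp
  · simp

variable {Ω}

theorem toBlocks_gram_of_mem_unitaryGroup :
    Ω ∈ Matrix.unitaryGroup (Fin L ⊕ Fin L) ℂ →
      Ω.toBlocks₁₁ᴴ * Ω.toBlocks₁₁ + Ω.toBlocks₂₁ᴴ * Ω.toBlocks₂₁ = 1 ∧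
      Ω.toBlocks₁₁ᴴ * Ω.toBlocks₁₂ + Ω.toBlocks₂₁ᴴ * Ω.toBlocks₂₂ = 0 ∧
      Ω.toBlocks₁₂ᴴ * Ω.toBlocks₁₁ + Ω.toBlocks₂₂ᴴ * Ω.toBlocks₂₁ = 0 ∧
      Ω.toBlocks₁₂ᴴ * Ω.toBlocks₁₂ + Ω.toBlocks₂₂ᴴ * Ω.toBlocks₂₂ = 1 := by
  intro h
  rw [Matrix.mem_unitaryGroup_iff', Matrix.star_eq_conjTranspose, ← fromBlocks_toBlocks Ω,
    fromBlocks_conjTranspose, fromBlocks_multiply, ← fromBlocks_one, fromBlocks_inj] at h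
  simpa using h

theorem conjTranspose_embedPair (i : ℕ) : (embedPair m i Ω)ᴴ = embedPair m i Ωᴴ := by
  have e₁₁ : Ωᴴ.toBlocks₁₁ = Ω.toBlocks₁₁ᴴ := rfl
  have e₁₂ : Ωᴴ.toBlocks₁₂ = Ω.toBlocks₂₁ᴴ := rfl
  have e₂₁ : Ωᴴ.toBlocks₂₁ = Ω.toBlocks₁₂ᴴ := rfl
  have e₂₂ : Ωᴴ.toBlocks₂₂ = Ω.toBlocks₂₂ᴴ := rfl
  have hblock : ∀ K : ℕ → ℕ → Matrix (Fin L) (Fin L) ℂ,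
      (blockMatrix m m K)ᴴ = blockMatrix m m fun a b => (K b a)ᴴ := fun K => rfl
  rw [embedPair, embedPair, hblock, e₁₁, e₁₂, e₂₁, e₂₂]
  congr 1
  funext a b
  split_ifs <;> first | rfl | omega | exact conjTranspose_one | exact conjTranspose_zero

/-- Block rows i and i + 1 of the Gram matrix reproduce the four block identities of Ωᴴ Ω = 1. The
bound on `i` matters: for i + 1 = m only the block Ω₁₁ would be kept. -/
theorem embedPair_mem_unitaryGroup {i : ℕ} (hi : i + 1 < m)
    (hΩ : Ω ∈ Matrix.unitaryGroup (Fin L ⊕ Fin L) ℂ) :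
    embedPair m i Ω ∈ Matrix.unitaryGroup (Fin m × Fin L) ℂ := by
  obtain ⟨h₁₁, h₁₂, h₂₁, h₂₂⟩ := toBlocks_gram_of_mem_unitaryGroup hΩ
  rw [Matrix.mem_unitaryGroup_iff', Matrix.star_eq_conjTranspose, conjTranspose_embedPair]
  have e₁₁ : Ωᴴ.toBlocks₁₁ = Ω.toBlocks₁₁ᴴ := rfl
  have e₁₂ : Ωᴴ.toBlocks₁₂ = Ω.toBlocks₂₁ᴴ := rfl
  have e₂₁ : Ωᴴ.toBlocks₂₁ = Ω.toBlocks₁₂ᴴ := rfl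
  have e₂₂ : Ωᴴ.toBlocks₂₂ = Ω.toBlocks₂₂ᴴ := rfl
  -- The block row formulas are stated for products, so a factor 1 is supplied.
  rw [← Matrix.mul_one (embedPair m i Ω)]
  apply rowBlock_ext
  intro a
  let x : Fin m := ⟨i, by omega⟩
  let y : Fin m := ⟨i + 1, hi⟩
  have f1 := rowBlock_embedPair_mul_fst Ω (i := x) (j := y) rfl (1 : Matrix (Fin m × Fin L) (Fin m × Fin L) ℂ)
  have f2 := rowBlock_embedPair_mul_snd Ω (i := x) (j := y) rfl (1 : Matrix (Fin m × Fin L) (Fin m × Fin L) ℂ)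
  by_cases h1 : a = x
  · subst h1
    have := rowBlock_embedPair_mul_fst Ωᴴ (i := x) (j := y) rfl (embedPair m i Ω * 1)
    refine this.trans ?_
    erw [f1, f2]
    rw [e₁₁, e₁₂, Matrix.mul_add, Matrix.mul_add, ← Matrix.mul_assoc, ← Matrix.mul_assoc,
      ← Matrix.mul_assoc, ← Matrix.mul_assoc, add_add_add_comm, ← Matrix.add_mul,
      ← Matrix.add_mul, h₁₁, h₁₂, Matrix.one_mul, Matrix.zero_mul, add_zero]
  by_cases h2 : a = y
  · subst h2
    have := rowBlock_embedPair_mul_snd Ωᴴ (i := x) (j := y) rfl (embedPair m i Ω * 1)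
    refine this.trans ?_
    erw [f1, f2]
    rw [e₂₁, e₂₂, Matrix.mul_add, Matrix.mul_add, ← Matrix.mul_assoc, ← Matrix.mul_assoc,
      ← Matrix.mul_assoc, ← Matrix.mul_assoc, add_add_add_comm, ← Matrix.add_mul,
      ← Matrix.add_mul, h₂₁, h₂₂, Matrix.one_mul, Matrix.zero_mul, zero_add]
  · have h1' : (a : ℕ) ≠ i := fun h => h1 (Fin.ext h)
    have h2' : (a : ℕ) ≠ i + 1 := fun h => h2 (Fin.ext h)
    rw [rowBlock_embedPair_mul_of_ne _ h1' h2', rowBlock_embedPair_mul_of_ne _ h1' h2']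

end BlockRows

/-! ### Products of transformations -/

section TransProd

variable {L m : ℕ} {γ : Type*} {Ω : ℕ → Matrix (Fin L ⊕ Fin L) (Fin L ⊕ Fin L) ℂ}

theorem transProd_mem_unitaryGroup {t : ℕ} (ht : t < m)
    (hΩ : ∀ i < t, Ω i ∈ Matrix.unitaryGroup (Fin L ⊕ Fin L) ℂ) :
    transProd m Ω t ∈ Matrix.unitaryGroup (Fin m × Fin L) ℂ := by
  induction t with
  | zero => exact one_mem _
  | succ t ih =>
    exact mul_mem (embedPair_mem_unitaryGroup ht (hΩ t t.lt_succ_self))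
      (ih (by omega) fun i hi => hΩ i (by omega))

/-- Transformations with index at least `i` keep the block rows below `i` of a column zero. -/
theorem transProd_mul_eq_zero_of_le {i t : ℕ} (hit : i ≤ t) (htm : t < m)
    {N : Matrix (Fin m × Fin L) γ ℂ} {c : γ}
    (h : ∀ (a : Fin m) (r : Fin L), i ≤ a → (transProd m Ω i * N) (a, r) c = 0) (a : Fin m)
    (r : Fin L) (ha : i ≤ a) : (transProd m Ω t * N) (a, r) c = 0 := by
  obtain ⟨d, rfl⟩ := Nat.exists_eq_add_of_le hit
  clear hit
  induction d generalizing a r with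
  | zero => exact h a r ha
  | succ d ih =>
    have hit : i ≤ i + d := Nat.le_add_right i d
    rw [← Nat.add_assoc] at htm ⊢
    set t := i + d
    have ih' := fun a r ha => ih a r ha (by omega)
    -- The next transformation mixes only rows that are already zero in column `c`, whatever its
    -- blocks are.
    have row : ∀ (P : Matrix (Fin L) (Fin L) ℂ) (b : Fin m) (r : Fin L), i ≤ b →
        (P * rowBlock (transProd m Ω t * N) b) r c = 0 := by
      intro P b r hb
      rw [Matrix.mul_apply]
      exact Finset.sum_eq_zero fun s _ => by
        rw [show rowBlock (transProd m Ω t * N) b s c = 0 from ih' b s hb, mul_zero]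
    change rowBlock (transProd m Ω (t + 1) * N) a r c = 0
    rw [transProd, Matrix.mul_assoc]
    let x : Fin m := ⟨t, by omega⟩
    let y : Fin m := ⟨t + 1, htm⟩
    by_cases h1 : a = x
    · rw [h1]
      have := rowBlock_embedPair_mul_fst (Ω t) (i := x) (j := y) rfl (transProd m Ω t * N)
      refine (congrFun (congrFun this r) c).trans ?_
      rw [Matrix.add_apply, row _ x r hit, row _ y r (by simp [y]; omega), add_zero]
    by_cases h2 : a = y
    · rw [h2]
      have := rowBlock_embedPair_mul_snd (Ω t) (i := x) (j := y) rfl (transProd m Ω t * N)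
      refine (congrFun (congrFun this r) c).trans ?_
      rw [Matrix.add_apply, row _ x r hit, row _ y r (by simp [y]; omega), add_zero]
    · rw [rowBlock_embedPair_mul_of_ne _ (fun h => h1 (Fin.ext h)) (fun h => h2 (Fin.ext h))]
      exact ih' a r ha

/-- The first `t` transformations do not involve the last block row if `t < m`. -/
theorem rowBlock_transProd_succ_mul {t : ℕ} (ht : t < m) (N : Matrix (Fin (m + 1) × Fin L) γ ℂ) :
    (∀ a : Fin m, rowBlock (transProd (m + 1) Ω t * N) a.castSucc =
      rowBlock (transProd m Ω t * N.submatrix (Prod.map Fin.castSucc id) id) a) ∧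
    rowBlock (transProd (m + 1) Ω t * N) (Fin.last m) = rowBlock N (Fin.last m) := by
  induction t with
  | zero =>
    simp only [transProd, Matrix.one_mul]
    exact ⟨fun a => rfl, trivial⟩
  | succ t ih =>
    obtain ⟨ih₁, ih₂⟩ := ih (by omega)
    simp only [transProd, Matrix.mul_assoc]
    refine ⟨fun a => ?_, ?_⟩
    · let x : Fin m := ⟨t, by omega⟩
      let y : Fin m := ⟨t + 1, ht⟩
      by_cases h1 : a = x
      · subst h1
        refine (rowBlock_embedPair_mul_fst (Ω t) (i := x.castSucc) (j := y.castSucc) rfl _).trans ?_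
        rw [ih₁, ih₁]
        exact (rowBlock_embedPair_mul_fst (Ω t) (i := x) (j := y) rfl _).symm
      by_cases h2 : a = y
      · subst h2
        refine (rowBlock_embedPair_mul_snd (Ω t) (i := x.castSucc) (j := y.castSucc) rfl _).trans ?_
        rw [ih₁, ih₁]
        exact (rowBlock_embedPair_mul_snd (Ω t) (i := x) (j := y) rfl _).symm
      · have h1' : (a : ℕ) ≠ t := fun h => h1 (Fin.ext h)
        have h2' : (a : ℕ) ≠ t + 1 := fun h => h2 (Fin.ext h)
        rw [rowBlock_embedPair_mul_of_ne _ h1' h2',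
          rowBlock_embedPair_mul_of_ne (a := a.castSucc) _ h1' h2', ih₁]
    · rw [rowBlock_embedPair_mul_of_ne, ih₂]
      · simp; omega
      · simp; omega

end TransProd

/-! ### Arnoldi bases of the block Krylov subspaces -/

section Krylov

variable {n L : ℕ}

theorem finrank_range_mulVecLin_le {ι : Type*} [Fintype ι] (W : Matrix (Fin n) ι ℂ) :
    Module.finrank ℂ (LinearMap.range W.mulVecLin) ≤ Fintype.card ι := by
  simpa using LinearMap.finrank_range_le W.mulVecLin

/-- Every generator is a column of `F` or `A` times an earlier generator. Both the inclusion into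
the Arnoldi span and the dimension count rest on this. -/
theorem blockKrylov_succ_le (A : Matrix (Fin n) (Fin n) ℂ) (F : Matrix (Fin n) (Fin L) ℂ)
    (j : ℕ) : blockKrylov A F (j + 1) ≤
      LinearMap.range F.mulVecLin ⊔ (blockKrylov A F j).map A.mulVecLin := by
  refine Submodule.span_le.2 ?_
  rintro v ⟨i, hi, c, rfl⟩
  cases i with
  | zero =>
    refine Submodule.mem_sup_left ⟨Pi.single c 1, ?_⟩
    simp
  | succ i =>
    refine Submodule.mem_sup_right ⟨(A ^ i * F).col c, Submodule.subset_span
      ⟨i, by omega, c, rfl⟩, ?_⟩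
    rw [pow_succ', Matrix.mul_assoc]
    rfl

/-- The matrix of Arnoldi vectors and its leading blocks satisfy the Arnoldi relation. -/
theorem IsBlockArnoldi.relation_of_le {A : Matrix (Fin n) (Fin n) ℂ}
    {F : Matrix (Fin n) (Fin L) ℂ} {j : ℕ} {V : ℕ → Matrix (Fin n) (Fin L) ℂ}
    {H : ℕ → ℕ → Matrix (Fin L) (Fin L) ℂ} {S : Matrix (Fin L) (Fin L) ℂ}
    (h : IsBlockArnoldi A F j V H S) {i : ℕ} (hi : i ≤ j) :
    A * blockRow i V = blockRow (i + 1) V * blockMatrix (i + 1) i H := by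
  ext r ⟨b, c⟩
  have key := congrFun (congrFun h.relation r) (Fin.castLE hi b, c)
  simp only [Matrix.mul_apply, blockRow, blockMatrix, of_apply, Fintype.sum_prod_type,
    Fin.val_castLE] at key ⊢
  -- Both sums become sums over ranges of naturals; the Hessenberg zeros account for the extra
  -- blocks.
  rw [key, Fin.sum_univ_eq_sum_range (fun a => ∑ s, V a r s * H a b s c),
    Fin.sum_univ_eq_sum_range (fun a => ∑ s, V a r s * H a b s c)]
  symm
  refine Finset.sum_subset (Finset.range_subset_range.2 (by omega)) ?_
  intro a ha ha'
  simp only [Finset.mem_range] at ha ha'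
  have hz : H a b = 0 := h.hessenberg a b (by omega) (by omega) (by omega)
  simp [hz]

theorem blockRow_mul_firstBlock (m : ℕ) (V : ℕ → Matrix (Fin n) (Fin L) ℂ) :
    blockRow (m + 1) V * firstBlock (L := L) (m + 1) = V 0 := by
  ext r c
  simp only [Matrix.mul_apply, blockRow, firstBlock, of_apply, Fintype.sum_prod_type]
  rw [Fin.sum_univ_succ]
  simp

/-- Induction: `F = V 0 * S` lies in the span of the first block, and by the Arnoldi relation `A`
maps the span of i blocks into that of i + 1. -/
theorem IsBlockArnoldi.blockKrylov_le {A : Matrix (Fin n) (Fin n) ℂ}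
    {F : Matrix (Fin n) (Fin L) ℂ} {j : ℕ} {V : ℕ → Matrix (Fin n) (Fin L) ℂ}
    {H : ℕ → ℕ → Matrix (Fin L) (Fin L) ℂ} {S : Matrix (Fin L) (Fin L) ℂ}
    (h : IsBlockArnoldi A F j V H S) {i : ℕ} (hi : i ≤ j + 1) :
    blockKrylov A F i ≤ LinearMap.range (blockRow i V).mulVecLin := by
  induction i with
  | zero => exact Submodule.span_le.2 fun v ⟨i, hi, _⟩ => absurd hi (Nat.not_lt_zero i)
  | succ i ih =>
    refine (blockKrylov_succ_le A F i).trans (sup_le ?_ ?_)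
    · rw [h.start, ← blockRow_mul_firstBlock i V, Matrix.mul_assoc, Matrix.mulVecLin_mul]
      exact LinearMap.range_comp_le_range _ _
    · refine (Submodule.map_mono (ih (by omega))).trans ?_
      rw [← LinearMap.range_comp, ← Matrix.mulVecLin_mul, h.relation_of_le (by omega),
        Matrix.mulVecLin_mul]
      exact LinearMap.range_comp_le_range _ _

/-- Without breakdown, the block Krylov subspaces are spanned by the Arnoldi vectors, and the
image of `F` meets `A K_k` trivially. -/
theorem IsBlockArnoldi.blockKrylov_eq {A : Matrix (Fin n) (Fin n) ℂ}
    {F : Matrix (Fin n) (Fin L) ℂ} {k : ℕ} {V : ℕ → Matrix (Fin n) (Fin L) ℂ}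
    {H : ℕ → ℕ → Matrix (Fin L) (Fin L) ℂ} {S : Matrix (Fin L) (Fin L) ℂ}
    (h : IsBlockArnoldi A F (k + 1) V H S)
    (hdim : Module.finrank ℂ (blockKrylov A F (k + 1)) = (k + 1) * L) :
    blockKrylov A F (k + 1) = LinearMap.range (blockRow (k + 1) V).mulVecLin ∧
    blockKrylov A F k = LinearMap.range (blockRow k V).mulVecLin ∧
    ∀ v, F *ᵥ v ∈ (blockKrylov A F k).map A.mulVecLin → v = 0 := by
  -- (k + 1) L ≤ rank F + dim A K_k - dim(range F ∩ A K_k) ≤ L + k L, so every estimate is an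
  -- equality: F is injective and the intersection is trivial.
  have d₁ := finrank_range_mulVecLin_le (blockRow (k + 1) V)
  have d₂ := finrank_range_mulVecLin_le (blockRow k V)
  have d₃ := finrank_range_mulVecLin_le F
  have d₄ := Submodule.finrank_mono (blockKrylov_succ_le A F k)
  have d₅ := Submodule.finrank_sup_add_finrank_inf_eq (LinearMap.range F.mulVecLin)
    ((blockKrylov A F k).map A.mulVecLin)
  have d₆ := Submodule.finrank_map_le A.mulVecLin (blockKrylov A F k)
  have d₇ := Submodule.finrank_mono (h.blockKrylov_le (i := k) (by omega))
  simp only [Fintype.card_prod, Fintype.card_fin] at d₁ d₂ d₃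
  rw [hdim] at d₄
  have hL : (k + 1) * L = k * L + L := by ring
  refine ⟨Submodule.eq_of_le_of_finrank_le (h.blockKrylov_le (by omega)) (by omega),
    Submodule.eq_of_le_of_finrank_le (h.blockKrylov_le (by omega)) (by omega), ?_⟩
  intro v hv
  have hinf : LinearMap.range F.mulVecLin ⊓ (blockKrylov A F k).map A.mulVecLin = ⊥ :=
    Submodule.finrank_eq_zero.1 (by omega)
  have hFv : F *ᵥ v = 0 := by
    have : F *ᵥ v ∈ LinearMap.range F.mulVecLin ⊓ (blockKrylov A F k).map A.mulVecLin :=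
      ⟨⟨v, rfl⟩, hv⟩
    simpa [hinf] using this
  have hker : LinearMap.ker F.mulVecLin = ⊥ := by
    have := LinearMap.finrank_range_add_finrank_ker F.mulVecLin
    rw [Module.finrank_fin_fun] at this
    exact Submodule.finrank_eq_zero.1 (by omega)
  exact LinearMap.ker_eq_bot'.1 hker v hFv

end Krylov

/-! ### Splitting off the last block; effect of the last transformation -/

section LastBlock

variable {k L : ℕ}

/-- Splitting off the last block. -/
def lastBlockEquiv (k L : ℕ) : (Fin k × Fin L) ⊕ Fin L ≃ Fin (k + 1) × Fin L where
  toFun := Sum.elim (Prod.map Fin.castSucc id) fun r => (Fin.last k, r)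
  invFun p := if h : (p.1 : ℕ) < k then Sum.inl (⟨p.1, h⟩, p.2) else Sum.inr p.2
  left_inv := by
    rintro (⟨a, r⟩ | r) <;> simp
  right_inv := by
    rintro ⟨a, r⟩
    by_cases h : (a : ℕ) < k
    · simp [h]
    · have : a = Fin.last k := Fin.ext (by simp; omega)
      subst this
      simp

theorem mul_eq_add_lastBlock {κ κ' : Type*} (P : Matrix κ (Fin (k + 1) × Fin L) ℂ)
    (X : Matrix (Fin (k + 1) × Fin L) κ' ℂ) :
    P * X = P.submatrix id (Prod.map Fin.castSucc id) * X.submatrix (Prod.map Fin.castSucc id) id +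
      P.submatrix id (fun r => (Fin.last k, r)) * X.submatrix (fun r => (Fin.last k, r)) id := by
  ext r c
  simp only [Matrix.mul_apply, Matrix.add_apply, submatrix_apply, id]
  rw [← (lastBlockEquiv k L).sum_comp, Fintype.sum_sum_type]
  rfl

theorem range_mulVecLin_mul_of_isUnit {n : ℕ} {ι : Type*} [Fintype ι] [DecidableEq ι]
    (W : Matrix (Fin n) ι ℂ) {U : Matrix ι ι ℂ} (hU : IsUnit U) :
    LinearMap.range (W * U).mulVecLin = LinearMap.range W.mulVecLin := by
  rw [Matrix.mulVecLin_mul]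
  exact LinearMap.range_comp_of_range_eq_top _
    (LinearMap.range_eq_top.2 (mulVec_surjective_iff_isUnit.2 hU))

theorem range_mulVecLin_fromCols_lastBlock {n : ℕ} (W : Matrix (Fin n) (Fin (k + 1) × Fin L) ℂ) :
    LinearMap.range (fromCols (W.submatrix id (Prod.map Fin.castSucc id))
      (W.submatrix id (fun r => (Fin.last k, r)))).mulVecLin = LinearMap.range W.mulVecLin := by
  have : fromCols (W.submatrix id (Prod.map Fin.castSucc id))
      (W.submatrix id (fun r => (Fin.last k, r))) = W.submatrix id (lastBlockEquiv k L) := by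
    ext r (c | c) <;> rfl
  rw [this]
  ext v
  constructor
  · rintro ⟨x, rfl⟩
    refine ⟨x ∘ (lastBlockEquiv k L).symm, ?_⟩
    ext r
    simp only [mulVecLin_apply, mulVec, dotProduct, submatrix_apply, id, Function.comp]
    rw [← (lastBlockEquiv k L).sum_comp]
    simp
  · rintro ⟨x, rfl⟩
    refine ⟨x ∘ lastBlockEquiv k L, ?_⟩
    ext r
    simp only [mulVecLin_apply, mulVec, dotProduct, submatrix_apply, id, Function.comp]
    exact (lastBlockEquiv k L).sum_comp fun p => W r p * x p

variable {H : ℕ → ℕ → Matrix (Fin L) (Fin L) ℂ}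
  {Ω : ℕ → Matrix (Fin L ⊕ Fin L) (Fin L ⊕ Fin L) ℂ}

/-- After `k` transformations the last block row of the square Hessenberg matrix vanishes left of
the diagonal. -/
theorem IsHessenbergQR.lastRow_eq_zero (h : IsHessenbergQR (k + 1) H Ω) :
    (transProd (k + 1) Ω k * blockMatrix (k + 1) (k + 1) H).submatrix
      (fun r => (Fin.last k, r)) (Prod.map Fin.castSucc id : Fin k × Fin L → _) = 0 := by
  ext r ⟨i, c⟩
  -- The annihilation hypothesis concerns k + 2 block rows; the first k transformations leave the
  -- extra row alone, so it transfers to the square matrix.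
  have hrow := (rowBlock_transProd_succ_mul (Ω := Ω) (Nat.lt_succ_self k)
    (blockMatrix (k + 2) (k + 1) H)).1 (Fin.last k)
  refine (congrFun (congrFun hrow r) (i.castSucc, c)).symm.trans ?_
  -- Block column i is clean below the diagonal after i + 1 ≤ k transformations, and later ones
  -- preserve this.
  refine transProd_mul_eq_zero_of_le (i := i + 1) (by omega) (by omega) ?_ _ r ?_
  · intro a r ha
    exact h.annihilates i.castSucc a r c (Or.inl ha)
  · simp

/-- The last transformation annihilates the last subdiagonal block. -/
theorem IsHessenbergQR.toBlocks_mul_eq_zero (h : IsHessenbergQR (k + 1) H Ω) :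
    (Ω k).toBlocks₂₁ * hatH k H Ω + (Ω k).toBlocks₂₂ * H (k + 1) k = 0 := by
  obtain ⟨h₁, h₂⟩ := rowBlock_transProd_succ_mul (Ω := Ω) (Nat.lt_succ_self k)
    (blockMatrix (k + 2) (k + 1) H)
  have h₃ := rowBlock_embedPair_mul_snd (Ω k) (i := (Fin.last k).castSucc)
    (j := Fin.last (k + 1)) rfl (transProd (k + 2) Ω k * blockMatrix (k + 2) (k + 1) H)
  -- In the last block column, the two rows being mixed are `hatH` and the still untouched
  -- subdiagonal block.
  rw [h₁, h₂, ← Matrix.mul_assoc] at h₃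
  ext r c
  have h₄ := congrFun (congrFun h₃ r) (Fin.last k, c)
  exact h₄.symm.trans (h.annihilates (Fin.last k) (Fin.last (k + 1)) r c (Or.inl (by simp)))

/-- The hypothesis says that Z maps the stacked pair (T, h) to (R', 0); applying Zᴴ recovers T and h
from R'. The last identity is the (1,1) block of Z Zᴴ = 1. -/
theorem toBlocks_factor {Z : Matrix (Fin L ⊕ Fin L) (Fin L ⊕ Fin L) ℂ}
    (hZ : Z ∈ Matrix.unitaryGroup (Fin L ⊕ Fin L) ℂ) {T h : Matrix (Fin L) (Fin L) ℂ}
    (h0 : Z.toBlocks₂₁ * T + Z.toBlocks₂₂ * h = 0) :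
    T = Z.toBlocks₁₁ᴴ * (Z.toBlocks₁₁ * T + Z.toBlocks₁₂ * h) ∧
    h = Z.toBlocks₁₂ᴴ * (Z.toBlocks₁₁ * T + Z.toBlocks₁₂ * h) ∧
    Z.toBlocks₁₁ * Z.toBlocks₁₁ᴴ + Z.toBlocks₁₂ * Z.toBlocks₁₂ᴴ = 1 := by
  obtain ⟨h₁₁, h₁₂, h₂₁, h₂₂⟩ := toBlocks_gram_of_mem_unitaryGroup hZ
  refine ⟨?_, ?_, ?_⟩
  · calc T = (Z.toBlocks₁₁ᴴ * Z.toBlocks₁₁ + Z.toBlocks₂₁ᴴ * Z.toBlocks₂₁) * T +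
          (Z.toBlocks₁₁ᴴ * Z.toBlocks₁₂ + Z.toBlocks₂₁ᴴ * Z.toBlocks₂₂) * h := by
          rw [h₁₁, h₁₂]; simp
      _ = Z.toBlocks₁₁ᴴ * (Z.toBlocks₁₁ * T + Z.toBlocks₁₂ * h) +
          Z.toBlocks₂₁ᴴ * (Z.toBlocks₂₁ * T + Z.toBlocks₂₂ * h) := by
          simp only [Matrix.add_mul, Matrix.mul_add, Matrix.mul_assoc]; abel
      _ = _ := by rw [h0]; simp
  · calc h = (Z.toBlocks₁₂ᴴ * Z.toBlocks₁₁ + Z.toBlocks₂₂ᴴ * Z.toBlocks₂₁) * T +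
          (Z.toBlocks₁₂ᴴ * Z.toBlocks₁₂ + Z.toBlocks₂₂ᴴ * Z.toBlocks₂₂) * h := by
          rw [h₂₁, h₂₂]; simp
      _ = Z.toBlocks₁₂ᴴ * (Z.toBlocks₁₁ * T + Z.toBlocks₁₂ * h) +
          Z.toBlocks₂₂ᴴ * (Z.toBlocks₂₁ * T + Z.toBlocks₂₂ * h) := by
          simp only [Matrix.add_mul, Matrix.mul_add, Matrix.mul_assoc]; abel
      _ = _ := by rw [h0]; simp
  · have := (toBlocks_gram_of_mem_unitaryGroup (Unitary.star_mem hZ)).1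
    have e₁₁ : (star Z).toBlocks₁₁ = Z.toBlocks₁₁ᴴ := rfl
    have e₂₁ : (star Z).toBlocks₂₁ = Z.toBlocks₁₂ᴴ := rfl
    simpa [e₁₁, e₂₁] using this

end LastBlock

/-! ### Consequences of the CS-decomposition -/

section CSDecomposition

variable {L : ℕ}

theorem conjTranspose_realDiag (c : Fin L → ℝ) : (realDiag c)ᴴ = realDiag c := by
  rw [realDiag, diagonal_conjTranspose]
  congr 1
  funext i
  exact Complex.conj_ofReal _

theorem realDiag_sq_add_sq {c s : Fin L → ℝ} (h : ∀ i, s i ^ 2 + c i ^ 2 = 1) :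
    realDiag c ^ 2 + realDiag s ^ 2 = 1 := by
  rw [realDiag, realDiag, diagonal_pow, diagonal_pow, diagonal_add, ← diagonal_one]
  congr 1
  funext i
  have := h i
  simp only [Pi.pow_apply]
  norm_cast
  linarith

variable {Z : Matrix (Fin L ⊕ Fin L) (Fin L ⊕ Fin L) ℂ} {U₁ U₂ V₁ V₂ M Q : Matrix (Fin L) (Fin L) ℂ}
  {c s : Fin L → ℝ}

theorem IsCSDecomposition.mul_conjTranspose_eq_one (h : IsCSDecomposition Z U₁ U₂ V₁ V₂ c s)
    (hM : M ∈ Matrix.unitaryGroup (Fin L) ℂ) (hQ : V₁ = M * Q) : Q * Qᴴ = 1 := by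
  have hQ' : Q = star M * V₁ := by
    rw [hQ, ← Matrix.mul_assoc, Matrix.mem_unitaryGroup_iff'.1 hM, Matrix.one_mul]
  have : Q ∈ Matrix.unitaryGroup (Fin L) ℂ := by
    rw [hQ']
    exact mul_mem (Unitary.star_mem hM) h.unitary_V₁
  exact Matrix.mem_unitaryGroup_iff.1 this

/-- `U₁` cancels in the Gram matrix, leaving V₁ 𝒞² V₁ᴴ, and `V₁ = M * Q` lets `M` move to the front.
-/
theorem IsCSDecomposition.gram_toBlocks₁₁_mul (h : IsCSDecomposition Z U₁ U₂ V₁ V₂ c s)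
    (hM : M ∈ Matrix.unitaryGroup (Fin L) ℂ) (hQ : V₁ = M * Q) (K : Matrix (Fin L) (Fin L) ℂ) :
    Z.toBlocks₁₁ᴴ * Z.toBlocks₁₁ * (M * K) = M * (Q * realDiag c ^ 2 * Qᴴ * K) := by
  have hM' : Mᴴ * M = 1 := Matrix.mem_unitaryGroup_iff'.1 hM
  have hU : U₁ᴴ * U₁ = 1 := Matrix.mem_unitaryGroup_iff'.1 h.unitary_U₁
  calc Z.toBlocks₁₁ᴴ * Z.toBlocks₁₁ * (M * K)
      = M * (Q * (realDiag c * (U₁ᴴ * U₁) * realDiag c) * Qᴴ * (Mᴴ * M) * K) := by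
        rw [h.block₁₁, hQ]
        simp only [conjTranspose_mul, conjTranspose_conjTranspose, conjTranspose_realDiag,
          Matrix.mul_assoc]
    _ = _ := by rw [hU, hM', Matrix.mul_one, Matrix.mul_one, sq]

end CSDecomposition

end BlockKrylov

/-! ### Assembly of the theorem -/

theorem mainTheorem5 {n L k : ℕ}
    (A : Matrix (Fin n) (Fin n) ℂ) (B X₀ : Matrix (Fin n) (Fin L) ℂ)
    (V : ℕ → Matrix (Fin n) (Fin L) ℂ) (H : ℕ → ℕ → Matrix (Fin L) (Fin L) ℂ)
    (S₀ : Matrix (Fin L) (Fin L) ℂ)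
    (Ω : ℕ → Matrix (Fin L ⊕ Fin L) (Fin L ⊕ Fin L) ℂ)
    (M Y : Matrix (Fin L) (Fin L) ℂ)
    (U₁ U₂ V₁ V₂ : Matrix (Fin L) (Fin L) ℂ) (c s : Fin L → ℝ)
    (Q : Matrix (Fin L) (Fin L) ℂ)
    -- the iteration is `j = k + 1`; no breakdown: the block Krylov subspace has full dimension
    (hdim : Module.finrank ℂ (BlockKrylov.blockKrylov A (B - A * X₀) (k + 1)) = (k + 1) * L)
    (harnoldi : BlockKrylov.IsBlockArnoldi A (B - A * X₀) (k + 1) V H S₀)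
    (hqr : BlockKrylov.IsHessenbergQR (k + 1) H Ω)
    -- QR factorization of the last diagonal block
    (hM : M ∈ Matrix.unitaryGroup (Fin L) ℂ) (hY : Y.BlockTriangular id)
    (hMY : BlockKrylov.hatH k H Ω = M * Y)
    (hcs : BlockKrylov.IsCSDecomposition (Ω k) U₁ U₂ V₁ V₂ c s)
    (hQ : V₁ = M * Q)
    (hH : IsUnit (BlockKrylov.blockMatrix (k + 1) (k + 1) H)) :
    (∃! X, BlockKrylov.IsBlockFOM A B X₀ (k + 1) X) ∧
    (∃! X, BlockKrylov.IsBlockGMRES A B X₀ (k + 1) X) ∧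
    (∃! X, BlockKrylov.IsBlockGMRES A B X₀ k X) ∧
    IsUnit (BlockKrylov.hatC k Ω Mᴴ S₀) ∧
    ∀ XF XG XGprev : Matrix (Fin n) (Fin L) ℂ,
      BlockKrylov.IsBlockFOM A B X₀ (k + 1) XF →
      BlockKrylov.IsBlockGMRES A B X₀ (k + 1) XG →
      BlockKrylov.IsBlockGMRES A B X₀ k XGprev →
      XG =
        XF * ((BlockKrylov.hatC k Ω Mᴴ S₀)⁻¹ * Q * BlockKrylov.realDiag c ^ 2 * Qᴴ *
          BlockKrylov.hatC k Ω Mᴴ S₀) +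
        XGprev * ((BlockKrylov.hatC k Ω Mᴴ S₀)⁻¹ * Q * BlockKrylov.realDiag s ^ 2 * Qᴴ *
          BlockKrylov.hatC k Ω Mᴴ S₀) := by
  obtain ⟨hK₁, hK, hF0⟩ := harnoldi.blockKrylov_eq hdim
  set Θ := BlockKrylov.transProd (k + 1) Ω k with hΘdef
  set W := BlockKrylov.blockRow (k + 1) V with hWdef
  set Hs := BlockKrylov.blockMatrix (k + 1) (k + 1) H with hHs
  set T := BlockKrylov.hatH k H Ω with hTdef
  let up : Fin k × Fin L → Fin (k + 1) × Fin L := Prod.map Fin.castSucc id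
  let lo : Fin L → Fin (k + 1) × Fin L := fun r => (Fin.last k, r)
  have hΘ : Θ ∈ unitaryGroup (Fin (k + 1) × Fin L) ℂ :=
    BlockKrylov.transProd_mem_unitaryGroup (Nat.lt_succ_self k) fun i hi =>
      hqr.unitary i (by omega)
  have hΘΘ : Θᴴ * Θ = 1 := mem_unitaryGroup_iff'.1 hΘ
  have hΘΘ' : Θ * Θᴴ = 1 := mem_unitaryGroup_iff.1 hΘ
  have hUΘ : IsUnit Θ := IsUnit.of_mul_eq_one _ hΘΘ'
  have hUΘ' : IsUnit Θᴴ := IsUnit.of_mul_eq_one _ hΘΘ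
  -- orthonormality
  have hWW : Wᴴ * W = 1 := by
    have h := congrArg (fun Z => Z.submatrix (Prod.map Fin.castSucc id)
      (Prod.map Fin.castSucc id)) harnoldi.orthonormal
    refine Eq.trans ?_ (h.trans (submatrix_one _
      ((Fin.castSucc_injective _).prodMap Function.injective_id)))
    rfl
  have hWV : Wᴴ * V (k + 1) = 0 := by
    have h := congrArg (fun Z => Z.submatrix (Prod.map Fin.castSucc id)
      (fun r : Fin L => (Fin.last (k + 1), r))) harnoldi.orthonormal
    refine Eq.trans ?_ (h.trans ?_)
    · rfl
    · ext ⟨a, r⟩ c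
      have : a.castSucc ≠ Fin.last (k + 1) := (Fin.castSucc_lt_last a).ne
      simp [this]
  have hVW : (V (k + 1))ᴴ * W = 0 := by
    have := congrArg conjTranspose hWV
    simpa using this
  have hVV : (V (k + 1))ᴴ * V (k + 1) = 1 := by
    have h := congrArg (fun Z => Z.submatrix (fun r : Fin L => (Fin.last (k + 1), r))
      (fun r : Fin L => (Fin.last (k + 1), r))) harnoldi.orthonormal
    refine Eq.trans ?_ (h.trans (submatrix_one _ (Prod.mk_right_injective _)))
    rfl
  -- the transformed basis
  set P := W * Θᴴ with hP
  have hPP : Pᴴ * P = 1 := by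
    rw [hP, conjTranspose_mul, conjTranspose_conjTranspose, Matrix.mul_assoc,
      ← Matrix.mul_assoc Wᴴ, hWW, Matrix.one_mul, hΘΘ']
  have hPV : Pᴴ * V (k + 1) = 0 := by
    rw [hP, conjTranspose_mul, Matrix.mul_assoc, hWV, Matrix.mul_zero]
  have hVP : (V (k + 1))ᴴ * P = 0 := by
    rw [hP, ← Matrix.mul_assoc, hVW, Matrix.zero_mul]
  have hWP : ∀ {κ : Type} (Z : Matrix (Fin (k + 1) × Fin L) κ ℂ), W * Z = P * (Θ * Z) := by
    intro κ Z
    rw [hP, Matrix.mul_assoc, ← Matrix.mul_assoc Θᴴ, hΘΘ, Matrix.one_mul]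
  have h₁₁ : (P.submatrix id up)ᴴ * P.submatrix id up = 1 :=
    Eq.trans (b := (Pᴴ * P).submatrix up up) rfl (by
      rw [hPP]
      exact submatrix_one _ ((Fin.castSucc_injective _).prodMap Function.injective_id))
  have h₂₂ : (P.submatrix id lo)ᴴ * P.submatrix id lo = 1 :=
    Eq.trans (b := (Pᴴ * P).submatrix lo lo) rfl (by
      rw [hPP]
      exact submatrix_one _ (Prod.mk_right_injective _))
  have h₁₂ : (P.submatrix id up)ᴴ * P.submatrix id lo = 0 :=
    Eq.trans (b := (Pᴴ * P).submatrix up lo) rfl (by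
      rw [hPP]
      ext ⟨a, r⟩ c
      have : a.castSucc ≠ Fin.last k := (Fin.castSucc_lt_last a).ne
      simp [up, lo, this])
  have h₂₁ : (P.submatrix id lo)ᴴ * P.submatrix id up = 0 := by
    have := congrArg conjTranspose h₁₂
    simpa using this
  have h₁₃ : (P.submatrix id up)ᴴ * V (k + 1) = 0 :=
    Eq.trans (b := (Pᴴ * V (k + 1)).submatrix up id) rfl (by rw [hPV]; rfl)
  have h₂₃ : (P.submatrix id lo)ᴴ * V (k + 1) = 0 :=
    Eq.trans (b := (Pᴴ * V (k + 1)).submatrix lo id) rfl (by rw [hPV]; rfl)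
  have h₃₂ : (V (k + 1))ᴴ * P.submatrix id lo = 0 :=
    Eq.trans (b := ((V (k + 1))ᴴ * P).submatrix id lo) rfl (by rw [hVP]; rfl)
  -- the transformed Hessenberg matrix
  set N := Θ * Hs with hN
  have hN₂₁ : N.submatrix lo up = 0 := hqr.lastRow_eq_zero
  have hN₂₂ : N.submatrix lo lo = T := rfl
  have hNblocks : N.submatrix (BlockKrylov.lastBlockEquiv k L) (BlockKrylov.lastBlockEquiv k L) =
      fromBlocks (N.submatrix up up) (N.submatrix up lo) 0 T := by
    rw [← hN₂₁, ← hN₂₂]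
    ext (a | a) (b | b) <;> rfl
  -- A block triangular matrix is invertible exactly when its diagonal blocks are; this is where
  -- nonsingularity of the Hessenberg matrix enters.
  have hRT : IsUnit (N.submatrix up up) ∧ IsUnit T := by
    rw [← isUnit_fromBlocks_zero₂₁ (B := N.submatrix up lo), ← hNblocks,
      isUnit_submatrix_equiv]
    exact hUΘ.mul hH
  have hRdet := (isUnit_iff_isUnit_det _).1 hRT.1
  have hTdet := (isUnit_iff_isUnit_det _).1 hRT.2
  set R := N.submatrix up up with hR
  have hA₁ : A * BlockKrylov.blockRow k V = P.submatrix id up * R := by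
    rw [harnoldi.relation_of_le (Nat.le_succ k)]
    have e : BlockKrylov.blockMatrix (k + 1) k H = Hs.submatrix id up := rfl
    rw [← hWdef, hWP, e, BlockKrylov.mul_eq_add_lastBlock]
    change P.submatrix id up * N.submatrix up up + P.submatrix id lo * N.submatrix lo up = _
    rw [hN₂₁, Matrix.mul_zero, add_zero]
  have hA₂ : A * V k = P.submatrix id up * N.submatrix up lo + P.submatrix id lo * T +
      V (k + 1) * H (k + 1) k := by
    have h := congrArg (fun Z => Z.submatrix id lo) harnoldi.relation
    have e₁ : A * V k = (A * W).submatrix id lo := rfl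
    refine e₁.trans (h.trans ?_)
    change BlockKrylov.blockRow (k + 2) V *
      (BlockKrylov.blockMatrix (k + 2) (k + 1) H).submatrix id lo = _
    rw [BlockKrylov.mul_eq_add_lastBlock]
    change W * Hs.submatrix id lo + V (k + 1) * H (k + 1) k = _
    rw [hWP, BlockKrylov.mul_eq_add_lastBlock]
    rfl
  -- the transformed right-hand side
  set G := Θ * (BlockKrylov.firstBlock (L := L) (k + 1) * S₀) with hG
  have hF : B - A * X₀ = P.submatrix id up * G.submatrix up id +
      P.submatrix id lo * G.submatrix lo id := by
    rw [harnoldi.start, ← BlockKrylov.blockRow_mul_firstBlock k V, Matrix.mul_assoc, ← hWdef, hWP]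
    exact BlockKrylov.mul_eq_add_lastBlock _ _
  have hM' : M * Mᴴ = 1 := mem_unitaryGroup_iff.1 hM
  have hC : BlockKrylov.hatC k Ω Mᴴ S₀ = Mᴴ * G.submatrix lo id := by
    have := BlockKrylov.rowBlock_embedSingle_mul (Fin.last k) Mᴴ G
    rw [hG, ← Matrix.mul_assoc] at this
    exact this
  have hC' : G.submatrix lo id = M * BlockKrylov.hatC k Ω Mᴴ S₀ := by
    rw [hC, ← Matrix.mul_assoc, hM', Matrix.one_mul]
  -- If this block kills v, then F₀ v lies in the range of P₁, which is A K_k because R is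
  -- invertible; absence of breakdown forces v = 0.
  have hUC : IsUnit (G.submatrix lo id) := by
    rw [← mulVec_injective_iff_isUnit]
    refine LinearMap.ker_eq_bot.1 ((LinearMap.ker_eq_bot' (f := (G.submatrix lo id).mulVecLin)).2
      fun v hv => ?_)
    refine hF0 v ?_
    rw [hK]
    refine ⟨_, ⟨R⁻¹ *ᵥ (G.submatrix up id *ᵥ v), rfl⟩, ?_⟩
    rw [mulVecLin_apply] at hv
    rw [mulVecLin_apply, mulVecLin_apply, Matrix.mulVec_mulVec, hA₁, Matrix.mulVec_mulVec,
      Matrix.mul_assoc, mul_nonsing_inv _ hRdet, Matrix.mul_one, hF, Matrix.add_mulVec,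
      ← Matrix.mulVec_mulVec _ (P.submatrix id lo), hv, Matrix.mulVec_zero, add_zero,
      Matrix.mulVec_mulVec]
  have hUhatC : IsUnit (BlockKrylov.hatC k Ω Mᴴ S₀) := by
    rw [hC]
    exact (IsUnit.of_mul_eq_one M (mem_unitaryGroup_iff'.1 hM)).mul hUC
  have hUdet := (isUnit_iff_isUnit_det _).1 hUhatC
  have hWcols : fromCols (BlockKrylov.blockRow k V) (V k) =
      fromCols (W.submatrix id up) (W.submatrix id lo) := rfl
  obtain ⟨h1, h2, h3, h4⟩ := BlockKrylov.blockGMRES_eq_of_blockTriangular (k := k) hK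
    (W₂ := V k) (by rw [hWcols, hK₁]; exact (BlockKrylov.range_mulVecLin_fromCols_lastBlock W).symm)
    (by
      rw [hK₁, ← BlockKrylov.range_mulVecLin_mul_of_isUnit W hUΘ']
      exact (BlockKrylov.range_mulVecLin_fromCols_lastBlock P).symm)
    h₁₁ h₁₂ h₂₁ h₂₂ h₁₃ h₂₃ h₃₂ hVV hA₁ hA₂ hF hRdet hTdet
  refine ⟨h1, h2, h3, hUhatC, fun XF XG XG' hXF hXG hXG' => ?_⟩
  obtain ⟨f₁, f₂, f₃⟩ := BlockKrylov.toBlocks_factor (hqr.unitary k (Nat.lt_succ_self k))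
    hqr.toBlocks_mul_eq_zero
  have hD : (BlockKrylov.hatC k Ω Mᴴ S₀)⁻¹ * Q * BlockKrylov.realDiag c ^ 2 * Qᴴ *
        BlockKrylov.hatC k Ω Mᴴ S₀ + (BlockKrylov.hatC k Ω Mᴴ S₀)⁻¹ * Q *
        BlockKrylov.realDiag s ^ 2 * Qᴴ * BlockKrylov.hatC k Ω Mᴴ S₀ = 1 := by
    rw [← Matrix.add_mul, ← Matrix.add_mul, ← Matrix.mul_add,
      BlockKrylov.realDiag_sq_add_sq hcs.sq_add_sq, Matrix.mul_one,
      Matrix.mul_assoc _ Q, hcs.mul_conjTranspose_eq_one hM hQ, Matrix.mul_one,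
      nonsing_inv_mul _ hUdet]
  refine h4 XF XG XG' hXF hXG hXG' _ _ hD
    (BlockKrylov.residual_balance hTdet f₁ f₂ f₃ ?_ hD)
  -- The remaining goal is aᴴ a C = C Dc, with C written as `M` times `hatC`; the factor Ĉ Ĉ⁻¹ then
  -- cancels.
  rw [hC', hcs.gram_toBlocks₁₁_mul hM hQ, Matrix.mul_assoc M]
  simp only [← Matrix.mul_assoc]
  rw [Matrix.mul_assoc M (BlockKrylov.hatC k Ω Mᴴ S₀), mul_nonsing_inv _ hUdet, Matrix.mul_one]
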